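/- **Theorem (Stability of the unknown-scale problem).** Let $T\in\mathbb N$ and let $\theta=(R_{a_s},t_{a_s},R_{b_s},t_{b_s})_{s=1}^T$, with $R_{a_s},R_{b_s}\in\mathbb R^{3\times3}$ and $t_{a_s},t_{b_s}\in\mathbb R^3$, be a vector of egomotion measurements of two sensors, with the Euclidean norm. Consider the unknown-scale (monocular) $\mathrm O(3)$-relaxed hand-eye calibration problem $$(P_\theta)\qquad \min_{R\in\mathbb R^{3\times 3},\,t\in\mathbb R^3,\,\alpha\in\mathbb R} f_\theta(R,t,\alpha)=\sum_{s=1}^T\|RR_{a_s}-R_{b_s}R\|_F^2+\sum_{s=1}^T\|Rt_{a_s}+t-R_{b_s}t-\alpha t_{b_s}\|_2^2\quad\text{s.t. } RR^{\mathsf T}=I .$$ Its Lagrangian is $L_\theta(R,t,\alpha;\Lambda)=f_\theta(R,t,\alpha)+\operatorname{tr}(\Lambda(I-RR^{\mathsf T}))=\operatorname{tr}\Lambda+x^{\mathsf T}Z_\theta(\Lambda)x$, where $\Lambda\in\mathbb R^{3\times3}$ is symmetric, $x=(t,\alpha,\operatorname{vec}R)\in\mathbb R^{13}$ and $Z_\theta(\Lambda)$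 is a symmetric matrix. The Lagrangian dual $\sup_\Lambda\inf_{R,t,\alpha}L_\theta$ is the semidefinite program $$(D_\theta)\qquad \max_{\Lambda=\Lambda^{\mathsf T}}\ \operatorname{tr}\Lambda\quad\text{s.t. } Z_\theta(\Lambda)\succeq0 .$$ Let $\bar\theta=(\bar R_{a_s},\bar t_{a_s},\bar R_{b_s},\bar t_{b_s})_{s}$ be noise-free: all $\bar R_{a_s},\bar R_{b_s}$ lie in $\mathrm{SO}(3)$ and there are a ground truth $R^\star\in\mathrm{SO}(3)$, $t^\star\in\mathbb R^3$ and a scale $\alpha^\star\in\mathbb R$ with $R^\star\bar R_{a_s}=\bar R_{b_s}R^\star$ and $R^\star\bar t_{a_s}+t^\star=\bar R_{b_s}t^\star+\alpha^\star\bar t_{b_s}$ for all $s$. Suppose that for some $i,j\in\{1,\dots,T\}$: 1. $\bar R_{b_i}\ne I$ and $\bar R_{b_j}\neq I$ are rotations about two distinct axes (lines through $0$); they are not both rotations by the angle $\pi$, and if one of them is a rotation by $\pi$, then the two axes are not perpendicular; 2. $\begin{bmatrix}R^\star\bar t_{a_i}\\ R^\star\bar t_{a_j}\end{bmatrix}$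 is not in the column space of $\begin{bmatrix}I-\bar R_{b_i}\\ I-\bar R_{b_j}\end{bmatrix}$. Then there is $\epsilon>0$ such that for every $\theta$ with $\|\theta-\bar\theta\|\le\epsilon$ strong duality holds for $(P_\theta)$, and its global optimum can be obtained from a solution of the dual problem: the optimal values of $(P_\theta)$ and of its Lagrangian dual are equal; $(P_\theta)$ and $(D_\theta)$ both have optimal solutions; and for every optimal solution $\Lambda$ of $(D_\theta)$, $\operatorname{tr}\Lambda$ is the optimal value of $(P_\theta)$, the null space of $Z_\theta(\Lambda)$ is one-dimensional and contains $(t,\alpha,\operatorname{vec}R)$ for every global minimizer $(R,t,\alpha)$ of $(P_\theta)$, and every nonzero vector of this null space is, up to a scalar factor, such a global minimizer. -/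

import Mathlib

open scoped Matrix Kronecker

namespace HandEye

/-- Real `3 × 3` matrices. -/
abbrev Mat3 := Matrix (Fin 3) (Fin 3) ℝ

/-- Vectors of three real coordinates. -/
abbrev Vec3 := Fin 3 → ℝ

/-- The squared Euclidean norm of a vector. -/
def normSq (v : Vec3) : ℝ := ∑ i, v i ^ 2

/-- The squared Frobenius norm of a matrix. -/
def frobSq (A : Mat3) : ℝ := ∑ i, ∑ j, A i j ^ 2

/-- The egomotion data of the two sensors over `T` time steps: incremental rotations and
translations of sensor `a`, and incremental rotations and (unscaled) translations of sensor `b`.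
The rotation entries are arbitrary matrices here, as in a vector of parameters of the cost
function; noise-free data have rotation matrices (see `IsNoiseFree`). -/
structure Measurements (T : ℕ) where
  Ra : Fin T → Mat3
  ta : Fin T → Vec3
  Rb : Fin T → Mat3
  tb : Fin T → Vec3

/-- The Euclidean distance between two parameter vectors (all entries stacked). -/
noncomputable def Measurements.distance {T : ℕ} (θ θ' : Measurements T) : ℝ :=
  √(∑ s, (frobSq (θ.Ra s - θ'.Ra s) + normSq (θ.ta s - θ'.ta s)
    + frobSq (θ.Rb s - θ'.Rb s) + normSq (θ.tb s - θ'.tb s)))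

/-- The decision variables: the extrinsic matrix `R`, the extrinsic translation `t` and the
scale `α`. -/
structure Calib where
  R : Mat3
  t : Vec3
  α : ℝ

/-- Coordinates of the stacked decision vector `(t, α, vec R)`; the last block is indexed by
(column, row). -/
abbrev Idx := (Fin 3 ⊕ Unit) ⊕ (Fin 3 × Fin 3)

/-- The stacked decision vector `(t, α, vec R)`, `vec` stacking the columns. -/
def Calib.toVec (p : Calib) : Idx → ℝ :=
  Sum.elim (Sum.elim p.t (fun _ => p.α)) p.R.vec

variable {T : ℕ}

/-! ### The unknown-scale calibration problem over `O(3)` -/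

/-- The rotation cost. -/
def costR (θ : Measurements T) (p : Calib) : ℝ :=
  ∑ s, frobSq (p.R * θ.Ra s - θ.Rb s * p.R)

/-- The translation cost, with unknown scale. -/
def costT (θ : Measurements T) (p : Calib) : ℝ :=
  ∑ s, normSq (p.R *ᵥ θ.ta s + p.t - θ.Rb s *ᵥ p.t - p.α • θ.tb s)

/-- The cost function. -/
def cost (θ : Measurements T) (p : Calib) : ℝ := costT θ p + costR θ p

/-- The constraint `R ∈ O(3)`. -/
def IsFeasible (p : Calib) : Prop := p.R * p.Rᵀ = 1

/-- `p` is a global minimizer of the problem. -/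
def IsPrimalSolution (θ : Measurements T) (p : Calib) : Prop :=
  IsFeasible p ∧ ∀ p' : Calib, IsFeasible p' → cost θ p ≤ cost θ p'

/-- The optimal value of the problem. -/
noncomputable def primalValue (θ : Measurements T) : EReal :=
  ⨅ p : {p : Calib // IsFeasible p}, (cost θ p : EReal)

/-! ### The Lagrangian dual -/

/-- The Lagrangian; the multiplier of the six scalar equations in `R Rᵀ = I` is a symmetric
matrix `Λ`. -/
def lagrangian (θ : Measurements T) (Λ : Mat3) (p : Calib) : ℝ :=
  cost θ p + (Λ * (1 - p.R * p.Rᵀ)).trace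

/-- The optimal value of the Lagrangian dual problem. -/
noncomputable def dualValue (θ : Measurements T) : EReal :=
  ⨆ Λ : {Λ : Mat3 // Λ.IsSymm}, ⨅ p : Calib, (lagrangian θ Λ p : EReal)

/-! ### The dual as a semidefinite program -/

/-- The matrix of the rotation residual at step `s`: `[0 | Raᵀ ⊗ I - I ⊗ Rb]`. -/
def resR (θ : Measurements T) (s : Fin T) : Matrix (Fin 3 × Fin 3) Idx ℝ :=
  Matrix.fromCols 0 ((θ.Ra s)ᵀ ⊗ₖ (1 : Mat3) - (1 : Mat3) ⊗ₖ θ.Rb s)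

/-- The matrix of the translation residual at step `s`: `[I - Rb | -tb | taᵀ ⊗ I]`. -/
def resT (θ : Measurements T) (s : Fin T) : Matrix (Fin 3) Idx ℝ :=
  Matrix.fromCols
    (Matrix.fromCols (1 - θ.Rb s) (Matrix.of fun i (_ : Unit) => -θ.tb s i))
    (Matrix.of fun i (c : Fin 3 × Fin 3) => θ.ta s c.1 * (1 : Mat3) i c.2)

/-- The symmetric cost matrix, in the coordinates `(t, α, vec R)`. -/
def costMatrix (θ : Measurements T) : Matrix Idx Idx ℝ :=
  ∑ s, ((resR θ s)ᵀ * resR θ s + (resT θ s)ᵀ * resT θ s)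

/-- The matrix `Z(Λ)` of the quadratic part of the Lagrangian (half of its Hessian). -/
def Z (θ : Measurements T) (Λ : Mat3) : Matrix Idx Idx ℝ :=
  costMatrix θ - Matrix.fromBlocks 0 0 0 ((1 : Mat3) ⊗ₖ Λ)

/-- Feasibility for the dual semidefinite program: maximize `tr Λ` subject to `Z(Λ) ⪰ 0`. -/
def IsDualFeasible (θ : Measurements T) (Λ : Mat3) : Prop :=
  Λ.IsSymm ∧ (Z θ Λ).PosSemidef

/-- `Λ` is an optimal solution of the dual semidefinite program. -/
def IsDualSolution (θ : Measurements T) (Λ : Mat3) : Prop :=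
  IsDualFeasible θ Λ ∧ ∀ Λ' : Mat3, IsDualFeasible θ Λ' → Λ'.trace ≤ Λ.trace

/-- Strong duality, together with recovery of the global optimum from the dual:
there is no duality gap between the problem and its Lagrangian dual; primal and dual optima are
attained, the optimum of the semidefinite program being the common value; and for every solution
`Λ` of the semidefinite program the null space of `Z(Λ)` is a line, it contains all global
minimizers, and each of its nonzero vectors is a global minimizer up to a scalar factor. -/
def StrongDualityWithRecovery (θ : Measurements T) : Prop :=
  primalValue θ = dualValue θ ∧
  (∃ p, IsPrimalSolution θ p) ∧
  (∃ Λ, IsDualSolution θ Λ) ∧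
  ∀ Λ, IsDualSolution θ Λ →
    primalValue θ = (Λ.trace : EReal) ∧
    Module.finrank ℝ (LinearMap.ker (Z θ Λ).mulVecLin) = 1 ∧
    (∀ p, IsPrimalSolution θ p → Z θ Λ *ᵥ p.toVec = 0) ∧
    (∀ z : Idx → ℝ, z ≠ 0 → Z θ Λ *ᵥ z = 0 →
      ∃ (c : ℝ) (p : Calib), IsPrimalSolution θ p ∧ p.toVec = c • z)

/-! ### Noise-free data and observability -/

/-- The data are exact egomotions of two rigidly connected sensors with extrinsic calibration
`(R, t)`, the translations of sensor `b` being known up to the scale `α`. -/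
structure IsNoiseFree (θ : Measurements T) (p : Calib) : Prop where
  rot : p.R ∈ Matrix.specialOrthogonalGroup (Fin 3) ℝ
  rot_a : ∀ s, θ.Ra s ∈ Matrix.specialOrthogonalGroup (Fin 3) ℝ
  rot_b : ∀ s, θ.Rb s ∈ Matrix.specialOrthogonalGroup (Fin 3) ℝ
  rot_eq : ∀ s, p.R * θ.Ra s = θ.Rb s * p.R
  transl_eq : ∀ s, p.R *ᵥ θ.ta s + p.t = θ.Rb s *ᵥ p.t + p.α • θ.tb s

/-- `u` spans (a part of) the axis of the rotation `A`. -/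
def IsAxis (A : Mat3) (u : Vec3) : Prop := u ≠ 0 ∧ A *ᵥ u = u

/-- For a rotation matrix: `A` is a rotation by the angle `π`. -/
def IsHalfTurn (A : Mat3) : Prop := A ≠ 1 ∧ A * A = 1

/-- `A` and `B` are nontrivial rotations about two distinct axes, not both half-turns, and if
one of them is a half-turn, then the axes are not perpendicular. -/
def RotateAboutDistinctAxes (A B : Mat3) : Prop :=
  A ≠ 1 ∧ B ≠ 1 ∧ ∃ u v : Vec3, IsAxis A u ∧ IsAxis B v ∧ LinearIndependent ℝ ![u, v] ∧
    ¬ (IsHalfTurn A ∧ IsHalfTurn B) ∧ (IsHalfTurn A ∨ IsHalfTurn B → u ⬝ᵥ v ≠ 0)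

/-- The stacked vector `(R ta_i, R ta_j)` is not in the span of the columns of the stacked matrix
`(I - Rb_i, I - Rb_j)`. -/
def SpanCondition (θ : Measurements T) (R : Mat3) (i j : Fin T) : Prop :=
  (Sum.elim (R *ᵥ θ.ta i) (R *ᵥ θ.ta j) : Fin 3 ⊕ Fin 3 → ℝ) ∉
    Submodule.span ℝ (Set.range (Matrix.fromRows (1 - θ.Rb i) (1 - θ.Rb j)).col)

/-! ### The matrices above represent the cost and the Lagrangian -/

theorem resR_mulVec (θ : Measurements T) (s : Fin T) (p : Calib) :
    resR θ s *ᵥ p.toVec = (p.R * θ.Ra s - θ.Rb s * p.R).vec := by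
  ext ⟨c, r⟩
  simp [resR, Calib.toVec, Matrix.mulVec, dotProduct, Fintype.sum_sum_type, Matrix.vec,
    Fintype.sum_prod_type, Matrix.mul_apply, Fin.sum_univ_three, Matrix.one_apply]
  fin_cases c <;> fin_cases r <;> simp <;> ring

theorem resT_mulVec (θ : Measurements T) (s : Fin T) (p : Calib) :
    resT θ s *ᵥ p.toVec = p.R *ᵥ θ.ta s + p.t - θ.Rb s *ᵥ p.t - p.α • θ.tb s := by
  ext i
  simp [resT, Calib.toVec, Matrix.mulVec, dotProduct, Fintype.sum_sum_type, Matrix.vec,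
    Fintype.sum_prod_type, Fin.sum_univ_three, Matrix.one_apply]
  fin_cases i <;> simp <;> ring

theorem cost_eq (θ : Measurements T) (p : Calib) :
    cost θ p = p.toVec ⬝ᵥ (costMatrix θ *ᵥ p.toVec) := by
  have hR : ∀ A : Mat3, frobSq A = A.vec ⬝ᵥ A.vec := by
    intro A
    simp only [frobSq, dotProduct, Matrix.vec, Fintype.sum_prod_type, pow_two]
    exact Finset.sum_comm
  have hT : ∀ v : Vec3, normSq v = v ⬝ᵥ v := by
    intro v
    simp only [normSq, dotProduct, pow_two]
  simp only [cost, costT, costR, hR, hT, ← resR_mulVec, ← resT_mulVec, costMatrix,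
    Matrix.sum_mulVec, dotProduct_sum, Matrix.add_mulVec, dotProduct_add,
    ← Matrix.mulVec_mulVec, Matrix.dotProduct_mulVec, Matrix.vecMul_transpose,
    Finset.sum_add_distrib]
  exact add_comm _ _

theorem lagrangian_eq (θ : Measurements T) (Λ : Mat3) (p : Calib) :
    lagrangian θ Λ p = Λ.trace + p.toVec ⬝ᵥ (Z θ Λ *ᵥ p.toVec) := by
  have h : (Λ * (p.R * p.Rᵀ)).trace = p.toVec ⬝ᵥ
      ((Matrix.fromBlocks 0 0 0 ((1 : Mat3) ⊗ₖ Λ) : Matrix Idx Idx ℝ) *ᵥ p.toVec) := by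
    simp [Calib.toVec, Matrix.mulVec, dotProduct, Fintype.sum_sum_type, Matrix.vec,
      Fintype.sum_prod_type, Matrix.mul_apply, Fin.sum_univ_three, Matrix.one_apply,
      Matrix.trace]
    ring
  rw [lagrangian, cost_eq, Z, Matrix.sub_mulVec, dotProduct_sub, ← h, mul_sub, mul_one,
    Matrix.trace_sub]
  ring

end HandEye

/-!
# Stability of the unknown-scale hand-eye calibration problem

For noise-free data the ground truth `x̄ = (t, α, vec R)` has zero cost, so the positive semidefinite
cost matrix `M̄` annihilates `x̄`. Its null space is the line through `x̄`
(`exists_smul_of_cost_eq_zero`): if `(t, α, R)` has zero cost, then `R` times the transpose of the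
true rotation commutes with the two given rotations of sensor `b`, and only scalar matrices do
(`eq_smul_one_of_commute`); after subtraction of a multiple of `x̄` the condition on the column space
forces `α = 0`, and then `t` lies on two distinct axes.

Hence `M̄ + x̄ x̄ᵀ` is positive definite, with a spectral gap `μ` which survives small perturbations.
For data near the noise-free ones, let `M` be the cost matrix.

* A global minimizer `p` exists (`exists_isPrimalSolution`), because the cost is coercive on the
  feasible set: `M` becomes positive definite when the constant `‖R‖² = 3` is added.
* Stationarity, along `t` and `α` and along rotations of `R`, provides the multiplier `Λ = G Rᵀ`,
  `G` the `R` block of `M p`. It is symmetric and `Z(Λ) p = 0`.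
* `Λ` is small (`IsPrimalSolution.abs_multiplier_le`): by Cauchy-Schwarz, the entries of `M p` are
  controlled by the minimal cost, which is at most the cost of `x̄`, hence small. No convergence of
  the minimizers is needed.
* Therefore `Z(Λ) + x̄ x̄ᵀ` inherits the spectral gap. Since `Z(Λ) p = 0` and `p` is not orthogonal to
  `x̄`, the matrix `Z(Λ)` is positive semidefinite with null space spanned by `p`
  (`posSemidef_of_mulVec_eq_zero`).

Such a pair `(p, Λ)` certifies strong duality and recovery
(`strongDualityWithRecovery_of_certificate`).
-/

open scoped Matrix Kronecker

namespace HandEye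

/-! ### Matrices commuting with two rotations -/

theorem exists_smul_of_cross_eq_zero {w y : Vec3} (hw : w ≠ 0) (h : w ⨯₃ y = 0) :
    ∃ k : ℝ, y = k • w := by
  by_contra! hk
  refine crossProduct_ne_zero_iff_linearIndependent.2 ?_ h
  rw [LinearIndependent.pair_iff' hw]
  exact fun a ha => hk a ha.symm

theorem dotProduct_self_pos {ι : Type*} [Fintype ι] {x : ι → ℝ} (hx : x ≠ 0) : 0 < x ⬝ᵥ x := by
  simpa using Matrix.dotProduct_star_self_pos_iff.2 hx

/-- Expansion of a vector in the basis `u, v, u × v`. -/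
theorem exists_eq_combination {u v : Vec3} (h : u ⨯₃ v ≠ 0) (y : Vec3) :
    ∃ a b c : ℝ, y = a • u + b • v + c • (u ⨯₃ v) := by
  have hw := (dotProduct_self_pos h).ne'
  -- Cramer's rule, the determinant of the basis being `w ⬝ᵥ w` with `w = u × v`
  refine ⟨((v ⨯₃ (u ⨯₃ v)) ⬝ᵥ y) / ((u ⨯₃ v) ⬝ᵥ (u ⨯₃ v)),
    (((u ⨯₃ v) ⨯₃ u) ⬝ᵥ y) / ((u ⨯₃ v) ⬝ᵥ (u ⨯₃ v)),
    ((u ⨯₃ v) ⬝ᵥ y) / ((u ⨯₃ v) ⬝ᵥ (u ⨯₃ v)), ?_⟩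
  ext i
  simp only [Pi.add_apply, Pi.smul_apply, smul_eq_mul, div_mul_eq_mul_div, ← add_div]
  rw [eq_div_iff hw]
  fin_cases i <;> simp [cross_apply, dotProduct, Fin.sum_univ_three] <;> ring

theorem eq_of_mulVec_eq {A B : Mat3} {u v : Vec3} (h : u ⨯₃ v ≠ 0) (hu : A *ᵥ u = B *ᵥ u)
    (hv : A *ᵥ v = B *ᵥ v) (hw : A *ᵥ (u ⨯₃ v) = B *ᵥ (u ⨯₃ v)) : A = B := by
  refine Matrix.ext_iff_mulVec.2 fun y => ?_
  obtain ⟨a, b, c, rfl⟩ := exists_eq_combination h y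
  simp only [Matrix.mulVec_add, Matrix.mulVec_smul, hu, hv, hw]

theorem transpose_mul_self_of_mem {A : Mat3} (hA : A ∈ Matrix.specialOrthogonalGroup (Fin 3) ℝ) :
    Aᵀ * A = 1 :=
  (Matrix.mem_orthogonalGroup_iff' (Fin 3) ℝ).1 (Matrix.mem_specialOrthogonalGroup_iff.1 hA).1

theorem self_mul_transpose_of_mem {A : Mat3} (hA : A ∈ Matrix.specialOrthogonalGroup (Fin 3) ℝ) :
    A * Aᵀ = 1 :=
  (Matrix.mem_orthogonalGroup_iff (Fin 3) ℝ).1 (Matrix.mem_specialOrthogonalGroup_iff.1 hA).1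

/-- Rotations preserve the cross product: the cofactor matrix of a rotation is the rotation. -/
theorem mulVec_cross {A : Mat3} (hA : A ∈ Matrix.specialOrthogonalGroup (Fin 3) ℝ) (x y : Vec3) :
    A *ᵥ (x ⨯₃ y) = (A *ᵥ x) ⨯₃ (A *ᵥ y) := by
  have hdet := (Matrix.mem_specialOrthogonalGroup_iff.1 hA).2
  have hadj : A.adjugate = Aᵀ := by
    calc A.adjugate = (Aᵀ * A) * A.adjugate := by
          rw [transpose_mul_self_of_mem hA, one_mul]
      _ = Aᵀ := by rw [mul_assoc, Matrix.mul_adjugate, hdet, one_smul, mul_one]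
  have hcof : (A.adjugate)ᵀ *ᵥ (x ⨯₃ y) = (A *ᵥ x) ⨯₃ (A *ᵥ y) := by
    rw [Matrix.adjugate_fin_three]
    ext i
    fin_cases i <;>
      simp [cross_apply, Matrix.mulVec, dotProduct, Fin.sum_univ_three] <;> ring
  rw [← hcof, hadj, Matrix.transpose_transpose]

theorem dotProduct_mulVec_eq {A : Mat3} {u : Vec3}
    (hA : A ∈ Matrix.specialOrthogonalGroup (Fin 3) ℝ) (hu : A *ᵥ u = u) (x : Vec3) :
    u ⬝ᵥ A *ᵥ x = u ⬝ᵥ x := by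
  have h : Aᵀ *ᵥ u = u := by
    conv_lhs => rw [← hu, Matrix.mulVec_mulVec, transpose_mul_self_of_mem hA, Matrix.one_mulVec]
  rw [Matrix.dotProduct_mulVec, ← Matrix.mulVec_transpose, h]

/-- The fixed space of a nontrivial rotation is its axis. -/
theorem exists_smul_of_mulVec_eq {A : Mat3} {u x : Vec3}
    (hA : A ∈ Matrix.specialOrthogonalGroup (Fin 3) ℝ) (hA1 : A ≠ 1) (hu : IsAxis A u)
    (hx : A *ᵥ x = x) : ∃ k : ℝ, x = k • u := by
  refine exists_smul_of_cross_eq_zero hu.1 ?_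
  by_contra h
  refine hA1 (eq_of_mulVec_eq h ?_ ?_ ?_)
  · rw [hu.2, Matrix.one_mulVec]
  · rw [hx, Matrix.one_mulVec]
  · rw [mulVec_cross hA, hu.2, hx, Matrix.one_mulVec]

/-- A rotation which maps a vector orthogonal to its axis to a multiple of that vector is a
half-turn. -/
theorem isHalfTurn_of_mulVec_eq_smul {A : Mat3} {u w : Vec3} {c : ℝ}
    (hA : A ∈ Matrix.specialOrthogonalGroup (Fin 3) ℝ) (hA1 : A ≠ 1) (hu : IsAxis A u)
    (hw : w ≠ 0) (huw : u ⬝ᵥ w = 0) (hc : A *ᵥ w = c • w) : IsHalfTurn A := by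
  have hww := dotProduct_self_pos hw
  have hne : u ⨯₃ w ≠ 0 := by
    intro h
    obtain ⟨k, rfl⟩ := exists_smul_of_cross_eq_zero hu.1 h
    rw [dotProduct_smul, smul_eq_mul] at huw
    rcases mul_eq_zero.1 huw with hk | hk
    · simp [hk] at hw
    · exact (dotProduct_self_pos hu.1).ne' hk
  have hc2 : c * c = 1 := by
    have h1 : (A *ᵥ w) ⬝ᵥ (A *ᵥ w) = w ⬝ᵥ w := by
      rw [Matrix.dotProduct_mulVec, ← Matrix.mulVec_transpose, Matrix.mulVec_mulVec,
        transpose_mul_self_of_mem hA, Matrix.one_mulVec]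
    rw [hc, smul_dotProduct, dotProduct_smul, smul_eq_mul, smul_eq_mul, ← mul_assoc] at h1
    exact (mul_eq_right₀ hww.ne').1 h1
  refine ⟨hA1, eq_of_mulVec_eq hne ?_ ?_ ?_⟩
  · rw [← Matrix.mulVec_mulVec, hu.2, hu.2, Matrix.one_mulVec]
  · rw [← Matrix.mulVec_mulVec, hc, Matrix.mulVec_smul, hc, smul_smul, hc2, one_smul,
      Matrix.one_mulVec]
  · rw [← Matrix.mulVec_mulVec, mulVec_cross hA, hu.2, hc, map_smul, Matrix.mulVec_smul,
      mulVec_cross hA, hu.2, hc, map_smul, smul_smul, hc2, one_smul, Matrix.one_mulVec]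

/-- A matrix commuting with a nontrivial rotation has the axis as an eigenspace, and so has its
transpose, with the same eigenvalue. -/
theorem exists_eigenvalue_of_commute {A Y : Mat3} {u : Vec3}
    (hA : A ∈ Matrix.specialOrthogonalGroup (Fin 3) ℝ) (hA1 : A ≠ 1) (hu : IsAxis A u)
    (hY : Y * A = A * Y) : ∃ l : ℝ, Y *ᵥ u = l • u ∧ ∀ x, u ⬝ᵥ Y *ᵥ x = l * (u ⬝ᵥ x) := by
  obtain ⟨l, hl⟩ := exists_smul_of_mulVec_eq (x := Y *ᵥ u) hA hA1 hu (by
    rw [Matrix.mulVec_mulVec, ← hY, ← Matrix.mulVec_mulVec, hu.2])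
  have hYt : A * Yᵀ = Yᵀ * A := by
    have h1 : Aᵀ * Yᵀ = Yᵀ * Aᵀ := by
      rw [← Matrix.transpose_mul, hY, Matrix.transpose_mul]
    calc A * Yᵀ = A * (Yᵀ * Aᵀ) * A := by
          rw [mul_assoc, mul_assoc, transpose_mul_self_of_mem hA, mul_one]
      _ = Yᵀ * A := by
          rw [← h1, ← mul_assoc, self_mul_transpose_of_mem hA, one_mul]
  obtain ⟨m, hm⟩ := exists_smul_of_mulVec_eq (x := Yᵀ *ᵥ u) hA hA1 hu (by
    rw [Matrix.mulVec_mulVec, hYt, ← Matrix.mulVec_mulVec, hu.2])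
  have hdot : ∀ x, u ⬝ᵥ Y *ᵥ x = m * (u ⬝ᵥ x) := fun x => by
    rw [Matrix.dotProduct_mulVec, ← Matrix.mulVec_transpose, hm, smul_dotProduct, smul_eq_mul]
  have hlm : l = m := by
    have h := hdot u
    rw [hl, dotProduct_smul, smul_eq_mul] at h
    exact mul_right_cancel₀ (dotProduct_self_pos hu.1).ne' h
  exact ⟨l, hl, hlm ▸ hdot⟩

/-- If `Y` commutes with a rotation `A` about `u` which is not a half-turn, and `u`, `v` and
`u × v` are eigenvectors of `Y`, then the eigenvalues of `v` and `u × v` coincide, and so does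
the one of `u` unless `u` and `v` are orthogonal: `A (u × v)` is an eigenvector with the
eigenvalue of `u × v`, and its expansion in the eigenbasis involves `v`, and involves `u` if
`u ⬝ᵥ v ≠ 0`. -/
theorem eigenvalues_eq_of_commute {A Y : Mat3} {u v : Vec3} {l n k : ℝ}
    (hA : A ∈ Matrix.specialOrthogonalGroup (Fin 3) ℝ) (hA1 : A ≠ 1) (hu : IsAxis A u)
    (hY : Y * A = A * Y) (hturn : ¬ IsHalfTurn A) (hw : u ⨯₃ v ≠ 0) (hl : Y *ᵥ u = l • u)
    (hn : Y *ᵥ v = n • v) (hk : Y *ᵥ (u ⨯₃ v) = k • (u ⨯₃ v)) :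
    n = k ∧ (u ⬝ᵥ v ≠ 0 → l = k) := by
  have huu := (dotProduct_self_pos hu.1).ne'
  obtain ⟨a, b, c, hy⟩ := exists_eq_combination hw (A *ᵥ (u ⨯₃ v))
  have hYy : Y *ᵥ (A *ᵥ (u ⨯₃ v)) = k • (A *ᵥ (u ⨯₃ v)) := by
    rw [Matrix.mulVec_mulVec, hY, ← Matrix.mulVec_mulVec, hk, Matrix.mulVec_smul]
  have hort : a * (u ⬝ᵥ u) + b * (u ⬝ᵥ v) = 0 := by
    have h := dotProduct_mulVec_eq hA hu.2 (u ⨯₃ v)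
    rw [hy] at h
    simpa [dotProduct_add, dotProduct_smul, dot_self_cross] using h
  have hb : b ≠ 0 := by
    rintro rfl
    have ha : a = 0 := by simpa [huu] using hort
    have hort' : u ⬝ᵥ (u ⨯₃ v) = 0 := dot_self_cross u v
    have hyc : A *ᵥ (u ⨯₃ v) = c • (u ⨯₃ v) := by
      rw [hy, ha, zero_smul, zero_smul, zero_add, zero_add]
    exact hturn (isHalfTurn_of_mulVec_eq_smul hA hA1 hu hw hort' hyc)
  have hcomb : (a * (l - k)) • u + (b * (n - k)) • v = 0 := by
    rw [hy] at hYy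
    simp only [Matrix.mulVec_add, Matrix.mulVec_smul, hl, hn, hk] at hYy
    generalize u ⨯₃ v = w at hYy
    ext i
    have h := congrFun hYy i
    simp only [Pi.add_apply, Pi.smul_apply, smul_eq_mul, Pi.zero_apply] at h ⊢
    linear_combination h
  have hind : LinearIndependent ℝ ![u, v] := crossProduct_ne_zero_iff_linearIndependent.1 hw
  have hli : a * (l - k) = 0 ∧ b * (n - k) = 0 := LinearIndependent.pair_iff.1 hind _ _ hcomb
  have hnk : n - k = 0 := (mul_eq_zero.1 hli.2).resolve_left hb
  refine ⟨sub_eq_zero.1 hnk, fun huv => ?_⟩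
  have ha : a ≠ 0 := by
    rintro rfl
    rw [zero_mul, zero_add] at hort
    exact mul_ne_zero hb huv hort
  have hlk : l - k = 0 := (mul_eq_zero.1 hli.1).resolve_left ha
  exact sub_eq_zero.1 hlk

/-- The hypothesis on the rotations enters the calibration problem only through this lemma: it
makes the extrinsic matrix unique up to a scalar factor. -/
theorem eq_smul_one_of_commute {A B Y : Mat3}
    (hA : A ∈ Matrix.specialOrthogonalGroup (Fin 3) ℝ)
    (hB : B ∈ Matrix.specialOrthogonalGroup (Fin 3) ℝ) (hAB : RotateAboutDistinctAxes A B)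
    (hYA : Y * A = A * Y) (hYB : Y * B = B * Y) : ∃ k : ℝ, Y = k • (1 : Mat3) := by
  obtain ⟨hA1, hB1, u, v, hu, hv, hli, hnot, hperp⟩ := hAB
  have hw : u ⨯₃ v ≠ 0 := crossProduct_ne_zero_iff_linearIndependent.2 hli
  have hw' : v ⨯₃ u ≠ 0 := by rw [← cross_anticomm]; exact neg_ne_zero.2 hw
  obtain ⟨l, hl, hl'⟩ := exists_eigenvalue_of_commute hA hA1 hu hYA
  obtain ⟨n, hn, hn'⟩ := exists_eigenvalue_of_commute hB hB1 hv hYB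
  obtain ⟨k, hk⟩ : ∃ k : ℝ, Y *ᵥ (u ⨯₃ v) = k • (u ⨯₃ v) := by
    refine exists_smul_of_cross_eq_zero hw ?_
    rw [cross_cross_eq_smul_sub_smul, hl', hn', dot_self_cross, dot_cross_self]
    simp
  have hk' : Y *ᵥ (v ⨯₃ u) = k • (v ⨯₃ u) := by
    rw [← cross_anticomm, Matrix.mulVec_neg, hk, smul_neg]
  -- the two eigenvalues on the axes agree when these are not orthogonal
  have hln : u ⬝ᵥ v ≠ 0 → l = n := fun huv => by
    have h := hl' v
    rw [hn, dotProduct_smul, smul_eq_mul] at h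
    exact (mul_right_cancel₀ huv h).symm
  have key : l = k ∧ n = k := by
    by_cases huv : u ⬝ᵥ v = 0
    · have hAt : ¬ IsHalfTurn A := fun h => hperp (Or.inl h) huv
      have hBt : ¬ IsHalfTurn B := fun h => hperp (Or.inr h) huv
      exact ⟨(eigenvalues_eq_of_commute hB hB1 hv hYB hBt hw' hn hl hk').1,
        (eigenvalues_eq_of_commute hA hA1 hu hYA hAt hw hl hn hk).1⟩
    · have h := hln huv
      by_cases hAt : IsHalfTurn A
      · have h2 := (eigenvalues_eq_of_commute hB hB1 hv hYB (fun hBt => hnot ⟨hAt, hBt⟩) hw' hn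
          hl hk').1
        exact ⟨h2, h ▸ h2⟩
      · have h2 := (eigenvalues_eq_of_commute hA hA1 hu hYA hAt hw hl hn hk).1
        exact ⟨h.trans h2, h2⟩
  refine ⟨k, eq_of_mulVec_eq hw ?_ ?_ ?_⟩
  · rw [hl, key.1, Matrix.smul_mulVec, Matrix.one_mulVec]
  · rw [hn, key.2, Matrix.smul_mulVec, Matrix.one_mulVec]
  · rw [hk, Matrix.smul_mulVec, Matrix.one_mulVec]

/-! ### The null space of the cost matrix for noise-free data -/

/-- The decision variables stacked in a vector. -/
def Calib.ofVec (x : Idx → ℝ) : Calib where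
  R := Matrix.of fun i j => x (Sum.inr (j, i))
  t := fun i => x (Sum.inl (Sum.inl i))
  α := x (Sum.inl (Sum.inr ()))

theorem Calib.toVec_ofVec (x : Idx → ℝ) : (Calib.ofVec x).toVec = x := by
  ext ((i | i) | ⟨i, j⟩) <;> rfl

theorem Calib.toVec_inr (p : Calib) (i j : Fin 3) : p.toVec (Sum.inr (j, i)) = p.R i j := rfl

theorem frobSq_nonneg (A : Mat3) : 0 ≤ frobSq A := by
  unfold frobSq; positivity

theorem normSq_nonneg (v : Vec3) : 0 ≤ normSq v := by
  unfold normSq; positivity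

theorem normSq_eq_zero {v : Vec3} : normSq v = 0 ↔ v = 0 := by
  rw [normSq, Finset.sum_eq_zero_iff_of_nonneg fun i _ => sq_nonneg _]
  simp [funext_iff]

theorem frobSq_eq_zero {A : Mat3} : frobSq A = 0 ↔ A = 0 := by
  refine ⟨fun h => ?_, fun h => by simp [h, frobSq]⟩
  ext i j
  have hi := (Finset.sum_eq_zero_iff_of_nonneg fun i _ =>
    Finset.sum_nonneg fun j _ => sq_nonneg (A i j)).1 h i (Finset.mem_univ i)
  have hij := (Finset.sum_eq_zero_iff_of_nonneg fun j _ => sq_nonneg (A i j)).1 hi j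
    (Finset.mem_univ j)
  exact pow_eq_zero_iff two_ne_zero |>.1 hij

variable {T : ℕ}

theorem cost_eq_zero_iff {θ : Measurements T} {p : Calib} :
    cost θ p = 0 ↔ ∀ s, p.R * θ.Ra s = θ.Rb s * p.R ∧
      p.R *ᵥ θ.ta s + p.t - θ.Rb s *ᵥ p.t = p.α • θ.tb s := by
  rw [cost, costT, costR, add_eq_zero_iff_of_nonneg
    (Finset.sum_nonneg fun s _ => normSq_nonneg _) (Finset.sum_nonneg fun s _ => frobSq_nonneg _),
    Finset.sum_eq_zero_iff_of_nonneg fun s _ => normSq_nonneg _,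
    Finset.sum_eq_zero_iff_of_nonneg fun s _ => frobSq_nonneg _]
  simp only [frobSq_eq_zero, normSq_eq_zero, sub_eq_zero, Finset.mem_univ, forall_const]
  exact ⟨fun h s => ⟨h.2 s, h.1 s⟩, fun h => ⟨fun s => (h s).2, fun s => (h s).1⟩⟩

theorem costMatrix_posSemidef (θ : Measurements T) : (costMatrix θ).PosSemidef := by
  refine Matrix.posSemidef_sum _ fun s _ => Matrix.PosSemidef.add ?_ ?_
  · exact Matrix.posSemidef_conjTranspose_mul_self (resR θ s)
  · exact Matrix.posSemidef_conjTranspose_mul_self (resT θ s)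

theorem IsNoiseFree.cost_eq_zero {θ : Measurements T} {truth : Calib}
    (hfree : IsNoiseFree θ truth) : cost θ truth = 0 := by
  refine cost_eq_zero_iff.2 fun s => ⟨hfree.rot_eq s, ?_⟩
  rw [hfree.transl_eq s, add_sub_cancel_left]

theorem mulVec_toVec_eq_zero_iff {θ : Measurements T} {p : Calib} :
    costMatrix θ *ᵥ p.toVec = 0 ↔ cost θ p = 0 := by
  rw [cost_eq, ← (costMatrix_posSemidef θ).dotProduct_mulVec_zero_iff, star_trivial]

theorem exists_smul_of_cost_eq_zero {θ : Measurements T} {truth p : Calib} {i j : Fin T}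
    (hfree : IsNoiseFree θ truth) (hrot : RotateAboutDistinctAxes (θ.Rb i) (θ.Rb j))
    (hspan : SpanCondition θ truth.R i j) (hp : cost θ p = 0) :
    ∃ k : ℝ, p.toVec = k • truth.toVec := by
  rw [cost_eq_zero_iff] at hp
  have hRR := self_mul_transpose_of_mem hfree.rot
  have hRR' := transpose_mul_self_of_mem hfree.rot
  have hcomm : ∀ s, p.R * truth.Rᵀ * θ.Rb s = θ.Rb s * (p.R * truth.Rᵀ) := fun s => by
    have h : truth.Rᵀ * θ.Rb s = θ.Ra s * truth.Rᵀ := by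
      calc truth.Rᵀ * θ.Rb s = truth.Rᵀ * (θ.Rb s * truth.R) * truth.Rᵀ := by
            rw [mul_assoc, mul_assoc, hRR, mul_one]
        _ = θ.Ra s * truth.Rᵀ := by
            rw [← hfree.rot_eq, ← mul_assoc, hRR', one_mul]
    rw [mul_assoc, h, ← mul_assoc, (hp s).1, mul_assoc]
  obtain ⟨k, hk⟩ := eq_smul_one_of_commute (hfree.rot_b i) (hfree.rot_b j) hrot (hcomm i) (hcomm j)
  have hR : p.R = k • truth.R := by
    calc p.R = p.R * truth.Rᵀ * truth.R := by rw [mul_assoc, hRR', mul_one]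
      _ = k • truth.R := by rw [hk, Matrix.smul_mul, one_mul]
  -- the difference to `k • truth` solves the translation equations with vanishing `R`
  have hdiff : ∀ s, (1 - θ.Rb s) *ᵥ (p.t - k • truth.t) = (p.α - k * truth.α) • θ.tb s := by
    intro s
    have h1 := (hp s).2
    have h2 := hfree.transl_eq s
    rw [hR, Matrix.smul_mulVec] at h1
    rw [Matrix.sub_mulVec, Matrix.one_mulVec, Matrix.mulVec_sub, Matrix.mulVec_smul, sub_smul,
      mul_smul, ← h1, ← sub_eq_iff_eq_add'.2 h2]
    module
  have hα : p.α - k * truth.α = 0 := by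
    by_contra hne
    set t' : Vec3 := (truth.α / (p.α - k * truth.α)) • (p.t - k • truth.t) - truth.t with ht'
    have hcol : ∀ s, (1 - θ.Rb s) *ᵥ t' = truth.R *ᵥ θ.ta s := by
      intro s
      rw [ht', Matrix.mulVec_sub, Matrix.mulVec_smul, hdiff, smul_smul, div_mul_cancel₀ _ hne,
        ← sub_eq_iff_eq_add'.2 (hfree.transl_eq s), Matrix.sub_mulVec, Matrix.one_mulVec]
      abel
    apply hspan
    rw [← Matrix.range_mulVecLin]
    refine ⟨t', ?_⟩
    rw [Matrix.mulVecLin_apply, Matrix.fromRows_mulVec, hcol, hcol]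
  have ht : p.t - k • truth.t = 0 := by
    have hfix : ∀ s, θ.Rb s *ᵥ (p.t - k • truth.t) = p.t - k • truth.t := fun s => by
      have h := hdiff s
      rw [hα, zero_smul, Matrix.sub_mulVec, Matrix.one_mulVec, sub_eq_zero] at h
      exact h.symm
    obtain ⟨hA1, hB1, u, v, hu, hv, hli, -⟩ := hrot
    obtain ⟨a, ha⟩ := exists_smul_of_mulVec_eq (hfree.rot_b i) hA1 hu (hfix i)
    obtain ⟨b, hb⟩ := exists_smul_of_mulVec_eq (hfree.rot_b j) hB1 hv (hfix j)
    have hab : a • u + (-b) • v = 0 := by rw [neg_smul, ← ha, ← hb, add_neg_cancel]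
    have ha0 : a = 0 := (LinearIndependent.pair_iff.1 hli _ _ hab).1
    rw [ha, ha0, zero_smul]
  refine ⟨k, ?_⟩
  ext ((l | l) | ⟨l, m⟩)
  · exact congrFun (sub_eq_zero.1 ht) l
  · exact sub_eq_zero.1 hα
  · exact congrFun (congrFun hR m) l

/-! ### Perturbation of quadratic forms -/

open Topology Filter

section QuadraticForms

variable {ι : Type*} [Fintype ι]

theorem continuous_quadraticForm :
    Continuous fun q : Matrix ι ι ℝ × (ι → ℝ) => q.2 ⬝ᵥ (q.1 *ᵥ q.2) := by
  fun_prop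

theorem isBounded_setOf_dotProduct_self_le (C : ℝ) :
    Bornology.IsBounded {x : ι → ℝ | x ⬝ᵥ x ≤ C} := by
  refine (Metric.isBounded_iff_subset_closedBall 0).2 ⟨√C, fun x hx => ?_⟩
  rw [mem_closedBall_zero_iff, pi_norm_le_iff_of_nonneg (Real.sqrt_nonneg C)]
  intro i
  refine Real.abs_le_sqrt ?_
  calc x i ^ 2 = x i * x i := sq _
    _ ≤ x ⬝ᵥ x :=
        Finset.single_le_sum (f := fun i => x i * x i) (fun i _ => mul_self_nonneg _)
          (Finset.mem_univ i)
    _ ≤ C := hx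

/-- Positive definiteness is uniform on the unit sphere, hence stable under perturbation. -/
theorem exists_eventually_le_quadraticForm {N : Matrix ι ι ℝ}
    (hN : ∀ x : ι → ℝ, x ≠ 0 → 0 < x ⬝ᵥ (N *ᵥ x)) :
    ∃ μ : ℝ, 0 < μ ∧ ∀ᶠ N' in 𝓝 N, ∀ x : ι → ℝ, μ * (x ⬝ᵥ x) ≤ x ⬝ᵥ (N' *ᵥ x) := by
  have hcpt : IsCompact {x : ι → ℝ | x ⬝ᵥ x = 1} :=
    Metric.isCompact_of_isClosed_isBounded (isClosed_eq (by fun_prop) continuous_const)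
      ((isBounded_setOf_dotProduct_self_le 1).subset fun x hx => le_of_eq hx)
  have hne : ∀ x : ι → ℝ, x ⬝ᵥ x = 1 → x ≠ 0 := by
    rintro x hx rfl
    simp at hx
  obtain ⟨μ, hμ, hlow⟩ : ∃ μ : ℝ, 0 < μ ∧ ∀ x : ι → ℝ, x ⬝ᵥ x = 1 → μ < x ⬝ᵥ (N *ᵥ x) := by
    rcases Set.eq_empty_or_nonempty {x : ι → ℝ | x ⬝ᵥ x = 1} with h | h
    · exact ⟨1, one_pos, fun x hx => absurd hx (Set.eq_empty_iff_forall_notMem.1 h x)⟩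
    · obtain ⟨x₀, hx₀, hmin⟩ := hcpt.exists_isMinOn h
        (f := fun x => x ⬝ᵥ (N *ᵥ x)) (by fun_prop)
      have hpos := hN x₀ (hne x₀ hx₀)
      exact ⟨_, half_pos hpos, fun x hx => (half_lt_self hpos).trans_le (hmin hx)⟩
  refine ⟨μ, hμ, ?_⟩
  have hev : ∀ᶠ N' in 𝓝 N, ∀ x ∈ {x : ι → ℝ | x ⬝ᵥ x = 1}, μ < x ⬝ᵥ (N' *ᵥ x) :=
    hcpt.eventually_forall_of_forall_eventually fun x hx =>
      continuous_quadraticForm.continuousAt.eventually (lt_mem_nhds (hlow x hx))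
  filter_upwards [hev] with N' hN' x
  rcases eq_or_ne x 0 with rfl | hx
  · simp
  · have hxx := dotProduct_self_pos hx
    have hsq : √(x ⬝ᵥ x) * √(x ⬝ᵥ x) = x ⬝ᵥ x := Real.mul_self_sqrt hxx.le
    have h := hN' ((√(x ⬝ᵥ x))⁻¹ • x) (by
      rw [smul_dotProduct, dotProduct_smul, smul_eq_mul, smul_eq_mul,
        ← mul_assoc, ← mul_inv, hsq, inv_mul_cancel₀ hxx.ne'])
    rw [Matrix.mulVec_smul, smul_dotProduct, dotProduct_smul, smul_eq_mul, smul_eq_mul,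
      ← mul_assoc, ← mul_inv, hsq, inv_mul_eq_div, lt_div_iff₀ hxx] at h
    exact h.le

/-- Two positive semidefinite forms with no common null vector have a positive definite sum. -/
theorem quadraticForm_add_pos {M S : Matrix ι ι ℝ} (hM : M.PosSemidef)
    (hS : ∀ x : ι → ℝ, 0 ≤ x ⬝ᵥ (S *ᵥ x))
    (h : ∀ x : ι → ℝ, M *ᵥ x = 0 → x ⬝ᵥ (S *ᵥ x) = 0 → x = 0) (x : ι → ℝ) (hx : x ≠ 0) :
    0 < x ⬝ᵥ ((M + S) *ᵥ x) := by
  have h1 : 0 ≤ x ⬝ᵥ (M *ᵥ x) := hM.dotProduct_mulVec_nonneg x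
  rw [Matrix.add_mulVec, dotProduct_add]
  refine (add_nonneg h1 (hS x)).lt_of_ne' fun h0 => hx ?_
  obtain ⟨h2, h3⟩ := (add_eq_zero_iff_of_nonneg h1 (hS x)).1 h0
  exact h x ((hM.dotProduct_mulVec_zero_iff x).1 h2) h3

theorem dotProduct_vecMulVec_self_mulVec (e x : ι → ℝ) :
    x ⬝ᵥ (Matrix.vecMulVec e e *ᵥ x) = (e ⬝ᵥ x) ^ 2 := by
  rw [Matrix.vecMulVec_mulVec, dotProduct_smul, op_smul_eq_smul, smul_eq_mul, dotProduct_comm x e,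
    sq]

theorem dotProduct_mulVec_comm {M : Matrix ι ι ℝ} (hM : M.IsHermitian) (x y : ι → ℝ) :
    x ⬝ᵥ (M *ᵥ y) = y ⬝ᵥ (M *ᵥ x) := by
  have hT : Mᵀ = M := hM
  rw [Matrix.dotProduct_mulVec, ← Matrix.mulVec_transpose, hT, dotProduct_comm]

/-- The Cauchy-Schwarz inequality of a positive semidefinite form, for a basis vector and `x`. -/
theorem mulVec_apply_sq_le [DecidableEq ι] {M : Matrix ι ι ℝ} (hM : M.PosSemidef) (x : ι → ℝ)
    (i : ι) : (M *ᵥ x) i ^ 2 ≤ M i i * (x ⬝ᵥ (M *ᵥ x)) := by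
  have h : ∀ s : ℝ, 0 ≤ M i i * (s * s) + 2 * (M *ᵥ x) i * s + x ⬝ᵥ (M *ᵥ x) := fun s => by
    have h0 : 0 ≤ (s • Pi.single i 1 + x) ⬝ᵥ (M *ᵥ (s • Pi.single i 1 + x)) :=
      hM.dotProduct_mulVec_nonneg (s • Pi.single i 1 + x)
    have h1 : x ⬝ᵥ (M *ᵥ Pi.single i 1) = (M *ᵥ x) i := by
      rw [dotProduct_mulVec_comm hM.1, single_one_dotProduct]
    have h2 : Pi.single i 1 ⬝ᵥ (M *ᵥ Pi.single i 1) = M i i := by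
      rw [single_one_dotProduct, Matrix.mulVec_single_one, Matrix.col_apply]
    simp only [Matrix.mulVec_add, Matrix.mulVec_smul, add_dotProduct, dotProduct_add,
      smul_dotProduct, dotProduct_smul, smul_eq_mul, h1, h2, single_one_dotProduct] at h0
    linarith
  have := discrim_le_zero h
  rw [discrim] at this
  linarith

/-- A form which annihilates a vector `p` not orthogonal to `e`, and which becomes positive
definite when the square of `e ⬝ᵥ ·` is added, is positive semidefinite with null space spanned by
`p`: modulo `p` every vector is orthogonal to `e`. -/
theorem posSemidef_of_mulVec_eq_zero {Z : Matrix ι ι ℝ} (hZ : Z.IsHermitian) {e p : ι → ℝ} {μ : ℝ}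
    (hμ : 0 < μ) (h : ∀ x : ι → ℝ, μ * (x ⬝ᵥ x) ≤ x ⬝ᵥ ((Z + Matrix.vecMulVec e e) *ᵥ x))
    (hp : Z *ᵥ p = 0) (hpe : e ⬝ᵥ p ≠ 0) :
    Z.PosSemidef ∧ ∀ x : ι → ℝ, Z *ᵥ x = 0 → ∃ a : ℝ, x = a • p := by
  have hdec : ∀ x : ι → ℝ, ∃ (a : ℝ) (y : ι → ℝ), x = a • p + y ∧ μ * (y ⬝ᵥ y) ≤ x ⬝ᵥ (Z *ᵥ x) := by
    intro x
    obtain ⟨y, hy⟩ : ∃ y, y = x - ((e ⬝ᵥ x) / (e ⬝ᵥ p)) • p := ⟨_, rfl⟩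
    have hxy : x = ((e ⬝ᵥ x) / (e ⬝ᵥ p)) • p + y := by rw [hy]; abel
    refine ⟨_, y, hxy, ?_⟩
    have hey : e ⬝ᵥ y = 0 := by
      rw [hy, dotProduct_sub, dotProduct_smul, smul_eq_mul, div_mul_cancel₀ _ hpe, sub_self]
    have hq : x ⬝ᵥ (Z *ᵥ x) = y ⬝ᵥ (Z *ᵥ y) := by
      have hZx : Z *ᵥ x = Z *ᵥ y := by
        rw [hy, Matrix.mulVec_sub, Matrix.mulVec_smul, hp, smul_zero, sub_zero]
      rw [hZx, dotProduct_mulVec_comm hZ, hZx]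
    have h1 := h y
    rw [Matrix.add_mulVec, dotProduct_add, dotProduct_vecMulVec_self_mulVec, hey] at h1
    rw [hq]
    linarith
  refine ⟨Matrix.PosSemidef.of_dotProduct_mulVec_nonneg hZ fun x => ?_, fun x hx => ?_⟩
  · obtain ⟨a, y, -, hy⟩ := hdec x
    exact (mul_nonneg hμ.le (Finset.sum_nonneg fun i _ => mul_self_nonneg _)).trans hy
  · obtain ⟨a, y, hxy, hy⟩ := hdec x
    rw [hx, dotProduct_zero] at hy
    by_cases hy0 : y = 0
    · exact ⟨a, by rw [hxy, hy0, add_zero]⟩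
    · exact absurd hy (not_le.2 (mul_pos hμ (dotProduct_self_pos hy0)))

end QuadraticForms

/-! ### Optimality certificates -/

theorem fromBlocks_kronecker_mulVec_toVec (Λ : Mat3) (p : Calib) :
    (Matrix.fromBlocks 0 0 0 ((1 : Mat3) ⊗ₖ Λ) : Matrix Idx Idx ℝ) *ᵥ p.toVec =
      Sum.elim (0 : Fin 3 ⊕ Unit → ℝ) (Λ * p.R).vec := by
  rw [Calib.toVec, Matrix.fromBlocks_mulVec, Sum.elim_comp_inr, Matrix.kronecker_mulVec_vec]
  simp

theorem Z_mulVec_toVec (θ : Measurements T) (Λ : Mat3) (p : Calib) :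
    Z θ Λ *ᵥ p.toVec = costMatrix θ *ᵥ p.toVec - Sum.elim (0 : Fin 3 ⊕ Unit → ℝ) (Λ * p.R).vec := by
  rw [Z, Matrix.sub_mulVec, fromBlocks_kronecker_mulVec_toVec]

theorem Z_isHermitian (θ : Measurements T) {Λ : Mat3} (hΛ : Λ.IsSymm) : (Z θ Λ).IsHermitian := by
  refine (costMatrix_posSemidef θ).1.sub ?_
  change (Matrix.fromBlocks 0 0 0 ((1 : Mat3) ⊗ₖ Λ))ᵀ = _
  have h : ((1 : Mat3) ⊗ₖ Λ)ᵀ = (1 : Mat3) ⊗ₖ Λ := by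
    rw [← Matrix.kroneckerMap_transpose, Matrix.transpose_one, hΛ.eq]
  rw [Matrix.fromBlocks_transpose, h]
  simp

theorem cost_eq_of_isFeasible (θ : Measurements T) (Λ : Mat3) {p : Calib} (hp : IsFeasible p) :
    cost θ p = Λ.trace + p.toVec ⬝ᵥ (Z θ Λ *ᵥ p.toVec) := by
  rw [← lagrangian_eq, lagrangian, show p.R * p.Rᵀ = 1 from hp, sub_self, mul_zero,
    Matrix.trace_zero, add_zero]

theorem transpose_mul_self_of_isFeasible {p : Calib} (hp : IsFeasible p) : p.Rᵀ * p.R = 1 :=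
  mul_eq_one_comm.1 hp

theorem Calib.toVec_ne_zero {p : Calib} (hp : IsFeasible p) : p.toVec ≠ 0 := by
  intro h
  have hR : p.R = 0 := by
    ext i j
    exact congrFun h (Sum.inr (j, i))
  have h1 : p.R * p.Rᵀ = 1 := hp
  rw [hR, zero_mul] at h1
  exact zero_ne_one h1

/-- A feasible point `p` and a multiplier `Λ` with `Z(Λ)` positive semidefinite and the null space
of `Z(Λ)` spanned by `p` certify strong duality and recovery. The multiplier is the only dual
solution, since a dual solution `Λ'` satisfies `Z(Λ') p = 0` by complementary slackness, whence
`Λ' R = Λ R`. -/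
theorem strongDualityWithRecovery_of_certificate {θ : Measurements T} {p : Calib} {Λ : Mat3}
    (hp : IsFeasible p) (hΛ : Λ.IsSymm) (hpos : (Z θ Λ).PosSemidef)
    (hZp : Z θ Λ *ᵥ p.toVec = 0)
    (hker : ∀ x, Z θ Λ *ᵥ x = 0 → ∃ a : ℝ, x = a • p.toVec) :
    StrongDualityWithRecovery θ := by
  have hpΛ : cost θ p = Λ.trace := by
    rw [cost_eq_of_isFeasible θ Λ hp, hZp, dotProduct_zero, add_zero]
  have hlag : ∀ q, Λ.trace ≤ lagrangian θ Λ q := fun q => by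
    rw [lagrangian_eq]
    exact le_add_of_nonneg_right (hpos.dotProduct_mulVec_nonneg q.toVec)
  have hsol : IsPrimalSolution θ p := ⟨hp, fun q hq => by
    rw [hpΛ, cost_eq_of_isFeasible θ Λ hq, ← lagrangian_eq]
    exact hlag q⟩
  have hval : primalValue θ = (Λ.trace : EReal) := by
    rw [primalValue, ← hpΛ]
    exact le_antisymm (iInf_le_of_le ⟨p, hp⟩ le_rfl)
      (le_iInf fun q => EReal.coe_le_coe_iff.2 (hsol.2 q q.2))
  have hdual : dualValue θ = (Λ.trace : EReal) := by
    refine le_antisymm (iSup_le fun Λ' => ?_) ?_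
    · refine (iInf_le _ p).trans (EReal.coe_le_coe_iff.2 (le_of_eq ?_))
      rw [lagrangian_eq, ← cost_eq_of_isFeasible θ Λ' hp, hpΛ]
    · exact le_iSup_of_le ⟨Λ, hΛ⟩ (le_iInf fun q => EReal.coe_le_coe_iff.2 (hlag q))
  have hdsol : IsDualSolution θ Λ := by
    refine ⟨⟨hΛ, hpos⟩, fun Λ' hΛ' => ?_⟩
    rw [← hpΛ, cost_eq_of_isFeasible θ Λ' hp]
    exact le_add_of_nonneg_right (hΛ'.2.dotProduct_mulVec_nonneg p.toVec)
  refine ⟨hval.trans hdual.symm, ⟨p, hsol⟩, ⟨Λ, hdsol⟩, fun Λ' hΛ' => ?_⟩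
  have htr : Λ'.trace = Λ.trace := le_antisymm (hdsol.2 Λ' hΛ'.1) (hΛ'.2 Λ hdsol.1)
  have hslack : ∀ q, IsPrimalSolution θ q → Z θ Λ' *ᵥ q.toVec = 0 := fun q hq => by
    have h1 : cost θ q = Λ'.trace := by
      rw [htr, ← hpΛ]
      exact le_antisymm (hq.2 p hp) (hsol.2 q hq.1)
    refine (hΛ'.1.2.dotProduct_mulVec_zero_iff _).1 ?_
    rw [star_trivial]
    linarith [cost_eq_of_isFeasible θ Λ' hq.1]
  obtain rfl : Λ' = Λ := by
    have h := hslack p hsol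
    rw [Z_mulVec_toVec, sub_eq_zero] at h
    rw [Z_mulVec_toVec, h, sub_eq_zero] at hZp
    have hR : Λ' * p.R = Λ * p.R :=
      Matrix.ext fun i j => congrFun hZp (Sum.inr (j, i))
    have h1 : p.R * p.Rᵀ = 1 := hp
    calc Λ' = Λ' * p.R * p.Rᵀ := by rw [mul_assoc, h1, mul_one]
      _ = Λ := by rw [hR, mul_assoc, h1, mul_one]
  refine ⟨hval, ?_, hslack, fun z hz0 hz => ?_⟩
  · refine finrank_eq_one_iff'.2 ⟨⟨p.toVec, hZp⟩, ?_, fun w => ?_⟩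
    · exact fun h => Calib.toVec_ne_zero hp (congrArg Subtype.val h)
    · obtain ⟨a, ha⟩ := hker w w.2
      exact ⟨a, Subtype.ext ha.symm⟩
  · obtain ⟨a, rfl⟩ := hker z hz
    have ha : a ≠ 0 := by
      rintro rfl
      exact hz0 (zero_smul _ _)
    exact ⟨a⁻¹, p, hsol, by rw [smul_smul, inv_mul_cancel₀ ha, one_smul]⟩

/-! ### The multiplier of a global minimizer -/

/-- The block of the half gradient `M x` of the cost in the direction of `R`. -/
def gradR (M : Matrix Idx Idx ℝ) (p : Calib) : Mat3 :=
  Matrix.of fun i j => (M *ᵥ p.toVec) (Sum.inr (j, i))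

/-- The Lagrange multiplier of a critical point `p`: the solution of `Λ R = G`, `G` the gradient
block, for orthogonal `R`. -/
def multiplier (M : Matrix Idx Idx ℝ) (p : Calib) : Mat3 := gradR M p * p.Rᵀ

theorem cost_toVec_add {θ : Measurements T} {p q : Calib} {d : Idx → ℝ}
    (h : q.toVec = p.toVec + d) :
    cost θ q = cost θ p + 2 * (d ⬝ᵥ (costMatrix θ *ᵥ p.toVec)) + d ⬝ᵥ (costMatrix θ *ᵥ d) := by
  rw [cost_eq, cost_eq, h, Matrix.mulVec_add, add_dotProduct, dotProduct_add, dotProduct_add,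
    dotProduct_mulVec_comm (costMatrix_posSemidef θ).1 p.toVec d]
  ring

/-- Stationarity in the unconstrained variables `t` and `α`. -/
theorem IsPrimalSolution.mulVec_inl {θ : Measurements T} {p : Calib} (hp : IsPrimalSolution θ p)
    (c : Fin 3 ⊕ Unit) : (costMatrix θ *ᵥ p.toVec) (Sum.inl c) = 0 := by
  have h : ∀ s : ℝ, 0 ≤ costMatrix θ (Sum.inl c) (Sum.inl c) * (s * s) +
      2 * (costMatrix θ *ᵥ p.toVec) (Sum.inl c) * s + 0 := fun s => by
    let q := Calib.ofVec (p.toVec + s • Pi.single (Sum.inl c) 1)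
    have hqR : q.R = p.R := by
      ext i j
      simp [q, Calib.ofVec, Calib.toVec_inr]
    have hq : IsFeasible q := by
      rw [IsFeasible, hqR]
      exact hp.1
    have h1 := hp.2 q hq
    rw [cost_toVec_add (Calib.toVec_ofVec _)] at h1
    simp only [Matrix.mulVec_smul, smul_dotProduct, dotProduct_smul, smul_eq_mul,
      single_one_dotProduct, Matrix.mulVec_single_one, Matrix.col_apply] at h1
    linarith
  have h2 := discrim_le_zero h
  rw [discrim] at h2
  nlinarith

/-- The orthogonal matrices `1 + sin τ K + (1 - cos τ) K²` of Rodrigues' formula. -/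
theorem rodrigues_mul_transpose {K : Mat3} (hK : Kᵀ = -K) (hK3 : K * K * K = -K) (τ : ℝ) :
    (1 + Real.sin τ • K + (1 - Real.cos τ) • (K * K)) *
      (1 + Real.sin τ • K + (1 - Real.cos τ) • (K * K))ᵀ = 1 := by
  have h3 : K * (K * K) = -K := by rw [← mul_assoc, hK3]
  have hs : Real.sin τ * Real.sin τ = 1 - Real.cos τ * Real.cos τ := by
    linarith [Real.sin_sq_add_cos_sq τ, sq (Real.sin τ), sq (Real.cos τ)]
  simp only [Matrix.transpose_add, Matrix.transpose_one, Matrix.transpose_smul,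
    Matrix.transpose_mul, hK, mul_add, add_mul, mul_one, one_mul, Matrix.smul_mul,
    Matrix.mul_smul, mul_neg, neg_mul, neg_neg, mul_assoc, h3, smul_neg, smul_smul, hs]
  module

/-- Stationarity along the rotations generated by a skew-symmetric matrix `K`. -/
theorem IsPrimalSolution.skew_dotProduct_eq_zero {θ : Measurements T} {p : Calib}
    (hp : IsPrimalSolution θ p) {K : Mat3} (hK : Kᵀ = -K) (hK3 : K * K * K = -K) :
    (Calib.mk (K * p.R) 0 0).toVec ⬝ᵥ (costMatrix θ *ᵥ p.toVec) = 0 := by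
  let k₁ := (Calib.mk (K * p.R) 0 0).toVec
  let k₂ := (Calib.mk (K * K * p.R) 0 0).toVec
  let M := costMatrix θ
  -- the cost along the curve `τ ↦ (1 + sin τ K + (1 - cos τ) K²) R`, minus the minimal cost
  let φ : ℝ → ℝ := fun τ =>
    2 * (Real.sin τ * (k₁ ⬝ᵥ (M *ᵥ p.toVec)) + (1 - Real.cos τ) * (k₂ ⬝ᵥ (M *ᵥ p.toVec)))
      + (Real.sin τ ^ 2 * (k₁ ⬝ᵥ (M *ᵥ k₁))
        + Real.sin τ * (1 - Real.cos τ) * (k₁ ⬝ᵥ (M *ᵥ k₂) + k₂ ⬝ᵥ (M *ᵥ k₁))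
        + (1 - Real.cos τ) ^ 2 * (k₂ ⬝ᵥ (M *ᵥ k₂)))
  have hφ : ∀ τ, 0 ≤ φ τ := fun τ => by
    let q : Calib := ⟨(1 + Real.sin τ • K + (1 - Real.cos τ) • (K * K)) * p.R, p.t, p.α⟩
    have hq : IsFeasible q := by
      have h1 : p.R * p.Rᵀ = 1 := hp.1
      change _ * p.R * (_ * p.R)ᵀ = 1
      rw [Matrix.transpose_mul, mul_assoc, ← mul_assoc p.R, h1, one_mul,
        rodrigues_mul_transpose hK hK3]
    have hqv : q.toVec = p.toVec + (Real.sin τ • k₁ + (1 - Real.cos τ) • k₂) := by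
      ext ((i | i) | ⟨i, j⟩)
      · simp [q, k₁, k₂, Calib.toVec]
      · simp [q, k₁, k₂, Calib.toVec]
      · simp [q, k₁, k₂, Calib.toVec, Matrix.vec, add_mul, add_assoc]
    have h := hp.2 q hq
    rw [cost_toVec_add hqv] at h
    simp only [Matrix.mulVec_add, Matrix.mulVec_smul, add_dotProduct, dotProduct_add,
      smul_dotProduct, dotProduct_smul, smul_eq_mul] at h
    simp only [φ, M]
    linarith
  have hφ0 : φ 0 = 0 := by simp [φ]
  have hmin : IsLocalMin φ 0 := Filter.Eventually.of_forall fun τ => by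
    rw [hφ0]
    exact hφ τ
  have hs : HasDerivAt Real.sin 1 0 := by simpa using Real.hasDerivAt_sin 0
  have hc : HasDerivAt (fun τ => 1 - Real.cos τ) 0 0 := by
    simpa using (Real.hasDerivAt_cos 0).const_sub 1
  have hd : HasDerivAt φ (2 * (k₁ ⬝ᵥ (M *ᵥ p.toVec))) 0 := by
    have h := (((hs.mul_const (k₁ ⬝ᵥ (M *ᵥ p.toVec))).add
      (hc.mul_const (k₂ ⬝ᵥ (M *ᵥ p.toVec)))).const_mul 2).add
      ((((hs.pow 2).mul_const (k₁ ⬝ᵥ (M *ᵥ k₁))).add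
        ((hs.mul hc).mul_const (k₁ ⬝ᵥ (M *ᵥ k₂) + k₂ ⬝ᵥ (M *ᵥ k₁)))).add
        ((hc.pow 2).mul_const (k₂ ⬝ᵥ (M *ᵥ k₂))))
    exact h.congr_deriv (by simp)
  have h0 := hmin.hasDerivAt_eq_zero hd
  have h1 : k₁ ⬝ᵥ (M *ᵥ p.toVec) = 0 := by linarith
  exact h1

theorem IsPrimalSolution.multiplier_isSymm {θ : Measurements T} {p : Calib}
    (hp : IsPrimalSolution θ p) : (multiplier (costMatrix θ) p).IsSymm := by
  have key : ∀ K : Mat3, Kᵀ = -K → K * K * K = -K →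
      ∑ j, ∑ i, (K * p.R) i j * gradR (costMatrix θ) p i j = 0 := fun K hK hK3 => by
    have h := hp.skew_dotProduct_eq_zero hK hK3
    rw [dotProduct, Fintype.sum_sum_type, Fintype.sum_sum_type] at h
    simpa [Calib.toVec, Matrix.vec, Fintype.sum_prod_type, gradR] using h
  have h01 := key !![0, 1, 0; -1, 0, 0; 0, 0, 0]
    (by ext i j; fin_cases i <;> fin_cases j <;> simp)
    (by ext i j; fin_cases i <;> fin_cases j <;> simp [Matrix.mul_apply, Fin.sum_univ_three])
  have h02 := key !![0, 0, 1; 0, 0, 0; -1, 0, 0]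
    (by ext i j; fin_cases i <;> fin_cases j <;> simp)
    (by ext i j; fin_cases i <;> fin_cases j <;> simp [Matrix.mul_apply, Fin.sum_univ_three])
  have h12 := key !![0, 0, 0; 0, 0, 1; 0, -1, 0]
    (by ext i j; fin_cases i <;> fin_cases j <;> simp)
    (by ext i j; fin_cases i <;> fin_cases j <;> simp [Matrix.mul_apply, Fin.sum_univ_three])
  simp [Matrix.mul_apply, Fin.sum_univ_three] at h01 h02 h12
  ext i j
  fin_cases i <;> fin_cases j <;>
    simp [multiplier, Matrix.mul_apply, Fin.sum_univ_three] <;> linarith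

theorem IsPrimalSolution.Z_multiplier_mulVec {θ : Measurements T} {p : Calib}
    (hp : IsPrimalSolution θ p) : Z θ (multiplier (costMatrix θ) p) *ᵥ p.toVec = 0 := by
  rw [Z_mulVec_toVec, sub_eq_zero, multiplier, mul_assoc, transpose_mul_self_of_isFeasible hp.1,
    mul_one]
  ext (c | ⟨j, i⟩)
  · exact hp.mulVec_inl c
  · rfl

/-! ### Perturbation of the calibration problem -/

theorem IsFeasible.sum_sq {p : Calib} (hp : IsFeasible p) : ∑ j, ∑ i, p.R i j ^ 2 = 3 := by
  have h : (p.R * p.Rᵀ).trace = 3 := by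
    rw [show p.R * p.Rᵀ = 1 from hp, Matrix.trace_one, Fintype.card_fin]
    norm_num
  rw [← h, Finset.sum_comm]
  simp [Matrix.trace, Matrix.mul_apply, sq]

theorem IsFeasible.abs_apply_le {p : Calib} (hp : IsFeasible p) (i j : Fin 3) :
    |p.R i j| ≤ 1 := by
  rw [← sq_le_one_iff_abs_le_one]
  have h : (p.R * p.Rᵀ) i i = 1 := by
    rw [show p.R * p.Rᵀ = 1 from hp, Matrix.one_apply_eq]
  rw [Matrix.mul_apply] at h
  calc p.R i j ^ 2 = p.R i j * p.Rᵀ j i := by rw [Matrix.transpose_apply, sq]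
    _ ≤ ∑ k, p.R i k * p.Rᵀ k i :=
        Finset.single_le_sum (f := fun k => p.R i k * p.Rᵀ k i)
          (fun k _ => mul_self_nonneg (p.R i k)) (Finset.mem_univ j)
    _ = 1 := h

theorem IsFeasible.le_dotProduct_self {p : Calib} (hp : IsFeasible p) :
    3 ≤ p.toVec ⬝ᵥ p.toVec := by
  have h : ∑ c : Fin 3 × Fin 3, p.toVec (Sum.inr c) * p.toVec (Sum.inr c) = 3 := by
    rw [← hp.sum_sq, Fintype.sum_prod_type]
    simp [Calib.toVec_inr, sq]
  rw [dotProduct, Fintype.sum_sum_type, h]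
  exact le_add_of_nonneg_left (Finset.sum_nonneg fun i _ => mul_self_nonneg _)

/-- The matrix of the quadratic form `‖R‖²` in the coordinates `(t, α, vec R)`. -/
def projR : Matrix Idx Idx ℝ := Matrix.fromBlocks 0 0 0 1

theorem dotProduct_projR_mulVec (x : Idx → ℝ) :
    x ⬝ᵥ (projR *ᵥ x) = ∑ c : Fin 3 × Fin 3, x (Sum.inr c) ^ 2 := by
  rw [projR, Matrix.fromBlocks_mulVec, dotProduct, Fintype.sum_sum_type]
  simp [sq]

theorem isClosed_setOf_isFeasible : IsClosed {x : Idx → ℝ | IsFeasible (Calib.ofVec x)} := by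
  have h : Continuous fun x : Idx → ℝ => (Calib.ofVec x).R := by
    refine continuous_matrix fun i j => ?_
    exact continuous_apply (Sum.inr (j, i))
  exact isClosed_eq (h.matrix_mul h.matrix_transpose) continuous_const

/-- A minimizer exists if the cost is coercive on the feasible set. Since `‖R‖² = 3` there,
it suffices that the cost matrix becomes positive definite when `‖R‖²` is added. -/
theorem exists_isPrimalSolution {θ : Measurements T} {p₀ : Calib} (hp₀ : IsFeasible p₀) {μ : ℝ}
    (hμ : 0 < μ)
    (h : ∀ x, μ * (x ⬝ᵥ x) ≤ x ⬝ᵥ ((costMatrix θ + projR) *ᵥ x)) :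
    ∃ p, IsPrimalSolution θ p := by
  have hco : ∀ q, IsFeasible q → cost θ q ≤ cost θ p₀ →
      q.toVec ⬝ᵥ q.toVec ≤ (cost θ p₀ + 3) / μ := fun q hq hle => by
    have h1 := h q.toVec
    rw [Matrix.add_mulVec, dotProduct_add, ← cost_eq, dotProduct_projR_mulVec,
      Fintype.sum_prod_type] at h1
    simp only [Calib.toVec_inr] at h1
    rw [hq.sum_sq] at h1
    rw [le_div_iff₀ hμ]
    linarith
  let S : Set (Idx → ℝ) :=
    {x | IsFeasible (Calib.ofVec x)} ∩ {x | x ⬝ᵥ x ≤ (cost θ p₀ + 3) / μ}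
  have hS : IsCompact S := by
    refine Metric.isCompact_of_isClosed_isBounded
      (isClosed_setOf_isFeasible.inter (isClosed_le (by fun_prop) continuous_const)) ?_
    exact (isBounded_setOf_dotProduct_self_le _).subset Set.inter_subset_right
  have hmem : ∀ q, IsFeasible q → cost θ q ≤ cost θ p₀ → q.toVec ∈ S := fun q hq hle =>
    ⟨hq, hco q hq hle⟩
  obtain ⟨x, hx, hmin⟩ := hS.exists_isMinOn ⟨_, hmem p₀ hp₀ le_rfl⟩
    (f := fun x => x ⬝ᵥ (costMatrix θ *ᵥ x)) (by fun_prop)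
  have hcost : ∀ q, IsFeasible q → cost θ q ≤ cost θ p₀ → cost θ (Calib.ofVec x) ≤ cost θ q :=
    fun q hq hle => by
      rw [cost_eq, cost_eq, Calib.toVec_ofVec]
      exact hmin (hmem q hq hle)
  refine ⟨Calib.ofVec x, hx.1, fun q hq => ?_⟩
  rcases le_total (cost θ q) (cost θ p₀) with hle | hle
  · exact hcost q hq hle
  · exact (hcost p₀ hp₀ le_rfl).trans hle

/-- The multiplier of a minimizer is small where the cost of some feasible point is small: by the
Cauchy-Schwarz inequality the gradient at the minimizer is controlled by the minimal cost. -/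
theorem IsPrimalSolution.abs_multiplier_le {θ : Measurements T} {p p₀ : Calib} {δ : ℝ}
    (hp : IsPrimalSolution θ p) (hp₀ : IsFeasible p₀) (hδ : 0 ≤ δ)
    (hsmall : ∀ c : Idx, costMatrix θ c c * cost θ p₀ ≤ δ ^ 2) (i j : Fin 3) :
    |multiplier (costMatrix θ) p i j| ≤ 3 * δ := by
  have hG : ∀ k, |gradR (costMatrix θ) p i k| ≤ δ := fun k => by
    refine abs_le_of_sq_le_sq ?_ hδ
    refine (mulVec_apply_sq_le (costMatrix_posSemidef θ) p.toVec (Sum.inr (k, i))).trans ?_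
    rw [← cost_eq]
    exact (mul_le_mul_of_nonneg_left (hp.2 p₀ hp₀) (costMatrix_posSemidef θ).diag_nonneg).trans
      (hsmall _)
  rw [multiplier, Matrix.mul_apply]
  calc |∑ k, gradR (costMatrix θ) p i k * p.Rᵀ k j|
      ≤ ∑ k, |gradR (costMatrix θ) p i k * p.Rᵀ k j| := Finset.abs_sum_le_sum_abs _ _
    _ ≤ ∑ _k : Fin 3, δ := by
        refine Finset.sum_le_sum fun k _ => ?_
        rw [abs_mul, ← mul_one δ]
        exact mul_le_mul (hG k) (hp.1.abs_apply_le j k) (abs_nonneg _) hδ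
    _ = 3 * δ := by simp

theorem exists_forall_abs_le_mem {W : Set Mat3} (hW : W ∈ 𝓝 (0 : Mat3)) :
    ∃ δ : ℝ, 0 < δ ∧ ∀ Λ : Mat3, (∀ i j, |Λ i j| ≤ δ) → Λ ∈ W := by
  obtain ⟨r, hr, hsub⟩ := (Metric.mem_nhds_iff (α := Fin 3 → Fin 3 → ℝ)).1 hW
  refine ⟨r / 2, half_pos hr, fun Λ hΛ => hsub ?_⟩
  refine Metric.mem_ball.2 (lt_of_le_of_lt ?_ (half_lt_self hr))
  refine (dist_pi_le_iff (half_pos hr).le).2 fun i => (dist_pi_le_iff (half_pos hr).le).2 fun j => ?_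
  rw [Real.dist_eq]
  simpa using hΛ i j

/-- Near a cost matrix with a feasible point of zero cost and one-dimensional null space, all
minimizers and their multipliers certify strong duality. -/
theorem eventually_strongDualityWithRecovery {θbar : Measurements T} {p₀ : Calib} (hp₀ : IsFeasible p₀)
    (hzero : cost θbar p₀ = 0)
    (hker : ∀ p, cost θbar p = 0 → ∃ k : ℝ, p.toVec = k • p₀.toVec) :
    ∀ᶠ M in 𝓝 (costMatrix θbar), ∀ θ : Measurements T, costMatrix θ = M →
      StrongDualityWithRecovery θ := by
  have hPSD := costMatrix_posSemidef θbar
  have hker' : ∀ x, costMatrix θbar *ᵥ x = 0 → ∃ k : ℝ, x = k • p₀.toVec := fun x hx => by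
    rw [← Calib.toVec_ofVec x] at hx ⊢
    exact hker _ (mulVec_toVec_eq_zero_iff.1 hx)
  obtain ⟨ν, hν, hcoercive⟩ := exists_eventually_le_quadraticForm
    (quadraticForm_add_pos (S := projR) hPSD
      (fun x => by rw [dotProduct_projR_mulVec]; exact Finset.sum_nonneg fun c _ => sq_nonneg _)
      (fun x hx h0 => by
        obtain ⟨k, rfl⟩ := hker' x hx
        rw [dotProduct_projR_mulVec, Fintype.sum_prod_type] at h0
        simp only [Pi.smul_apply, Calib.toVec_inr, smul_eq_mul, mul_pow, ← Finset.mul_sum,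
          hp₀.sum_sq] at h0
        have hk : k = 0 := by simpa using h0
        rw [hk, zero_smul]))
  obtain ⟨μ, hμ, hgap⟩ := exists_eventually_le_quadraticForm
    (quadraticForm_add_pos (S := Matrix.vecMulVec p₀.toVec p₀.toVec) hPSD
      (fun x => by rw [dotProduct_vecMulVec_self_mulVec]; exact sq_nonneg _)
      (fun x hx h0 => by
        obtain ⟨k, rfl⟩ := hker' x hx
        have hpp := (dotProduct_self_pos (Calib.toVec_ne_zero hp₀)).ne'
        rw [dotProduct_vecMulVec_self_mulVec, dotProduct_smul, smul_eq_mul] at h0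
        have hk : k = 0 := by simpa [hpp] using h0
        rw [hk, zero_smul]))
  -- the spectral gap persists under small perturbations of the cost matrix and of the multiplier
  have hcont : Continuous fun q : Matrix Idx Idx ℝ × Mat3 =>
      q.1 - Matrix.fromBlocks 0 0 0 ((1 : Mat3) ⊗ₖ q.2) +
        Matrix.vecMulVec p₀.toVec p₀.toVec := by
    refine (continuous_fst.sub (Continuous.matrix_fromBlocks continuous_const continuous_const
      continuous_const ?_)).add continuous_const
    refine continuous_matrix fun a b => ?_
    simp only [Matrix.kroneckerMap_apply]
    fun_prop
  have hlim : Tendsto (fun q : Matrix Idx Idx ℝ × Mat3 =>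
      q.1 - Matrix.fromBlocks 0 0 0 ((1 : Mat3) ⊗ₖ q.2) + Matrix.vecMulVec p₀.toVec p₀.toVec)
      (𝓝 (costMatrix θbar) ×ˢ 𝓝 0)
      (𝓝 (costMatrix θbar + Matrix.vecMulVec p₀.toVec p₀.toVec)) := by
    have h := hcont.tendsto (costMatrix θbar, 0)
    rw [nhds_prod_eq] at h
    simpa using h
  obtain ⟨P, hP, Q, hQ, hPQ⟩ := eventually_prod_iff.1 (hlim.eventually hgap)
  obtain ⟨δ, hδ, hQδ⟩ := exists_forall_abs_le_mem hQ
  have hsmall : ∀ c, ∀ᶠ M in 𝓝 (costMatrix θbar),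
      M c c * (p₀.toVec ⬝ᵥ (M *ᵥ p₀.toVec)) < (δ / 3) ^ 2 := fun c => by
    have hc : Continuous fun M : Matrix Idx Idx ℝ => M c c * (p₀.toVec ⬝ᵥ (M *ᵥ p₀.toVec)) := by
      fun_prop
    refine hc.continuousAt.eventually (gt_mem_nhds ?_)
    beta_reduce
    rw [← cost_eq, hzero, mul_zero]
    positivity
  have hlow : ∀ᶠ M in 𝓝 (costMatrix θbar), p₀.toVec ⬝ᵥ (M *ᵥ p₀.toVec) < μ * 3 := by
    have hc : Continuous fun M : Matrix Idx Idx ℝ => p₀.toVec ⬝ᵥ (M *ᵥ p₀.toVec) := by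
      fun_prop
    refine hc.continuousAt.eventually (gt_mem_nhds ?_)
    beta_reduce
    rw [← cost_eq, hzero]
    positivity
  have hcoercive' : ∀ᶠ M in 𝓝 (costMatrix θbar),
      ∀ x, ν * (x ⬝ᵥ x) ≤ x ⬝ᵥ ((M + projR) *ᵥ x) :=
    ((continuous_id.add continuous_const).tendsto (costMatrix θbar)).eventually hcoercive
  filter_upwards [hcoercive', hP, eventually_all.2 hsmall, hlow] with M h1 h2 h3 h4 θ hθ
  subst hθ
  rw [← cost_eq] at h4
  obtain ⟨p, hp⟩ := exists_isPrimalSolution hp₀ hν h1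
  have hgap' := fun Λ : Mat3 => fun hΛ : Q Λ => hPQ h2 hΛ
  have hQ0 : Q 0 := hQδ 0 fun i j => by simpa using hδ.le
  -- the minimizer is not orthogonal to `p₀`, its cost being below the spectral gap
  have hne : p₀.toVec ⬝ᵥ p.toVec ≠ 0 := fun h0 => by
    have h5 := hgap' 0 hQ0 p.toVec
    simp only [Matrix.kronecker_zero, Matrix.fromBlocks_zero, sub_zero] at h5
    rw [Matrix.add_mulVec, dotProduct_add, dotProduct_vecMulVec_self_mulVec, h0, ← cost_eq] at h5
    have h6 := hp.2 p₀ hp₀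
    have h7 := mul_le_mul_of_nonneg_left hp.1.le_dotProduct_self hμ.le
    linarith
  have hΛ : Q (multiplier (costMatrix θ) p) := hQδ _ fun i j => by
    have h5 := hp.abs_multiplier_le hp₀ (δ := δ / 3) (by positivity)
      (fun c => by rw [cost_eq]; exact (h3 c).le) i j
    linarith
  obtain ⟨hpos, hker''⟩ := posSemidef_of_mulVec_eq_zero (Z_isHermitian θ hp.multiplier_isSymm) hμ
    (hgap' _ hΛ) hp.Z_multiplier_mulVec hne
  exact strongDualityWithRecovery_of_certificate hp.1 hp.multiplier_isSymm hpos
    hp.Z_multiplier_mulVec hker''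

/-! ### Continuous dependence of the cost matrix on the data -/

theorem continuous_costMatrix : Continuous fun d : (Fin T → Mat3) × (Fin T → Vec3) ×
    (Fin T → Mat3) × (Fin T → Vec3) => costMatrix ⟨d.1, d.2.1, d.2.2.1, d.2.2.2⟩ := by
  refine continuous_finsetSum _ fun s _ => ?_
  have hR : Continuous fun d : (Fin T → Mat3) × (Fin T → Vec3) × (Fin T → Mat3) ×
      (Fin T → Vec3) => resR ⟨d.1, d.2.1, d.2.2.1, d.2.2.2⟩ s := by
    refine continuous_matrix fun a b => ?_
    rcases b with b | b
    · simp only [resR, Matrix.fromCols_apply_inl]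
      exact continuous_const
    · simp only [resR, Matrix.fromCols_apply_inr, Matrix.sub_apply, Matrix.kroneckerMap_apply,
        Matrix.transpose_apply]
      fun_prop
  have hT : Continuous fun d : (Fin T → Mat3) × (Fin T → Vec3) × (Fin T → Mat3) ×
      (Fin T → Vec3) => resT ⟨d.1, d.2.1, d.2.2.1, d.2.2.2⟩ s := by
    refine continuous_matrix fun a b => ?_
    rcases b with (b | b) | b
    · simp only [resT, Matrix.fromCols_apply_inl, Matrix.sub_apply]
      fun_prop
    · simp only [resT, Matrix.fromCols_apply_inl, Matrix.fromCols_apply_inr, Matrix.of_apply]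
      fun_prop
    · simp only [resT, Matrix.fromCols_apply_inr, Matrix.of_apply]
      fun_prop
  exact (hR.matrix_transpose.matrix_mul hR).add (hT.matrix_transpose.matrix_mul hT)

theorem sq_apply_le_frobSq (A : Mat3) (i j : Fin 3) : A i j ^ 2 ≤ frobSq A :=
  (Finset.single_le_sum (f := fun j => A i j ^ 2) (fun j _ => sq_nonneg (A i j))
    (Finset.mem_univ j)).trans
    (Finset.single_le_sum (f := fun i => ∑ j, A i j ^ 2)
      (fun i _ => Finset.sum_nonneg fun j _ => sq_nonneg (A i j)) (Finset.mem_univ i))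

theorem sq_apply_le_normSq (v : Vec3) (i : Fin 3) : v i ^ 2 ≤ normSq v :=
  Finset.single_le_sum (f := fun i => v i ^ 2) (fun i _ => sq_nonneg (v i)) (Finset.mem_univ i)

theorem Measurements.abs_sub_le_distance (θ θ' : Measurements T) (s : Fin T) (i : Fin 3) :
    (∀ j, |θ.Ra s i j - θ'.Ra s i j| ≤ θ.distance θ') ∧
      |θ.ta s i - θ'.ta s i| ≤ θ.distance θ' ∧
      (∀ j, |θ.Rb s i j - θ'.Rb s i j| ≤ θ.distance θ') ∧
      |θ.tb s i - θ'.tb s i| ≤ θ.distance θ' := by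
  have hs := Finset.single_le_sum (f := fun s => frobSq (θ.Ra s - θ'.Ra s)
    + normSq (θ.ta s - θ'.ta s) + frobSq (θ.Rb s - θ'.Rb s) + normSq (θ.tb s - θ'.tb s))
    (fun s _ => add_nonneg (add_nonneg (add_nonneg (frobSq_nonneg _) (normSq_nonneg _))
      (frobSq_nonneg _)) (normSq_nonneg _)) (Finset.mem_univ s)
  have h1 := frobSq_nonneg (θ.Ra s - θ'.Ra s)
  have h2 := normSq_nonneg (θ.ta s - θ'.ta s)
  have h3 := frobSq_nonneg (θ.Rb s - θ'.Rb s)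
  have h4 := normSq_nonneg (θ.tb s - θ'.tb s)
  refine ⟨fun j => Real.abs_le_sqrt ?_, Real.abs_le_sqrt ?_, fun j => Real.abs_le_sqrt ?_,
    Real.abs_le_sqrt ?_⟩
  · have := sq_apply_le_frobSq (θ.Ra s - θ'.Ra s) i j
    rw [Matrix.sub_apply] at this
    linarith
  · have := sq_apply_le_normSq (θ.ta s - θ'.ta s) i
    rw [Pi.sub_apply] at this
    linarith
  · have := sq_apply_le_frobSq (θ.Rb s - θ'.Rb s) i j
    rw [Matrix.sub_apply] at this
    linarith
  · have := sq_apply_le_normSq (θ.tb s - θ'.tb s) i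
    rw [Pi.sub_apply] at this
    linarith

theorem exists_distance_le_of_eventually {θbar : Measurements T}
    {P : Matrix Idx Idx ℝ → Prop} (hP : ∀ᶠ M in 𝓝 (costMatrix θbar), P M) :
    ∃ ε : ℝ, 0 < ε ∧ ∀ θ : Measurements T, θ.distance θbar ≤ ε → P (costMatrix θ) := by
  have h := (continuous_costMatrix.tendsto
    (θbar.Ra, θbar.ta, θbar.Rb, θbar.tb)).eventually hP
  obtain ⟨r, hr, hsub⟩ := (Metric.eventually_nhds_iff (α := (Fin T → Fin 3 → Fin 3 → ℝ) ×
    (Fin T → Vec3) × (Fin T → Fin 3 → Fin 3 → ℝ) × (Fin T → Vec3))).1 h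
  refine ⟨r / 2, half_pos hr, fun θ hθ => ?_⟩
  have hr2 := (half_pos hr).le
  refine @hsub (θ.Ra, θ.ta, θ.Rb, θ.tb) (lt_of_le_of_lt ?_ (half_lt_self hr))
  have hd := fun s i => θ.abs_sub_le_distance θbar s i
  refine max_le ?_ (max_le ?_ (max_le ?_ ?_))
  · exact (dist_pi_le_iff hr2).2 fun s => (dist_pi_le_iff hr2).2 fun i =>
      (dist_pi_le_iff hr2).2 fun j => ((hd s i).1 j).trans hθ
  · exact (dist_pi_le_iff hr2).2 fun s => (dist_pi_le_iff hr2).2 fun i => (hd s i).2.1.trans hθ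
  · exact (dist_pi_le_iff hr2).2 fun s => (dist_pi_le_iff hr2).2 fun i =>
      (dist_pi_le_iff hr2).2 fun j => ((hd s i).2.2.1 j).trans hθ
  · exact (dist_pi_le_iff hr2).2 fun s => (dist_pi_le_iff hr2).2 fun i => (hd s i).2.2.2.trans hθ

end HandEye

theorem mainTheorem2 {T : ℕ} (θbar : HandEye.Measurements T) (truth : HandEye.Calib)
    (hfree : HandEye.IsNoiseFree θbar truth)
    (hobs : ∃ i j : Fin T,
      HandEye.RotateAboutDistinctAxes (θbar.Rb i) (θbar.Rb j) ∧
      HandEye.SpanCondition θbar truth.R i j) :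
    ∃ ε : ℝ, 0 < ε ∧ ∀ θ : HandEye.Measurements T,
      θ.distance θbar ≤ ε → HandEye.StrongDualityWithRecovery θ := by
  obtain ⟨i, j, hrot, hspan⟩ := hobs
  obtain ⟨ε, hε, h⟩ := HandEye.exists_distance_le_of_eventually
    (HandEye.eventually_strongDualityWithRecovery (HandEye.self_mul_transpose_of_mem hfree.rot)
      hfree.cost_eq_zero fun p hp => HandEye.exists_smul_of_cost_eq_zero hfree hrot hspan hp)
  exact ⟨ε, hε, fun θ hθ => h θ hθ θ rfl⟩
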